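/- For a finite graph $G=(V,E)$ and an integer $R\ge 1$, a phase of the Klein–Plotkin–Rao (KPR) procedure, applied to the graph $G\setminus F$ that remains after removing a set $F$ of edges, does the following. For every connected component $C$ of $G\setminus F$, a root $r\in C$ is chosen, a number $k$ is drawn uniformly at random from $\{0,1,\dots,R-1\}$ (independently over components and phases), and all edges of $C$ that are at a level $\ell\equiv k \pmod R$ of the breadth-first search of $C$ from $r$ are removed; here an edge is at level $\ell$ if its end points are at distances $\ell$ and $\ell+1$ from $r$ in $C$. KPR starts with $F=\emptyset$ and runs three phases; KPR$_+$ is the same procedure with one additional phase, that is, with four phases. Two vertices are separated if they lie in different connected components of the final graph. Write $\rho_{uv}=d(u,v)/R$, where $d(u,v)$ is the shortest-path distance in $G$. With adversarial choices of roots, the root of each component in each phase is prescribed by an adversary, who may use the phase, the remaining graph and the component. **Corollary.** For all natural numbers $n$ and $d$ with $1\le d\le \frac{\sqrt n}{3}$ there exist a connected planar graph $G_d$ with $n$ vertices, vertices $u,v\in V(G_d)$ with $d(u,v)=d$, and an adversarial choice of roots such that, for every integer $R>2d$, KPR$_+$ with these roots and parameter $R$ separates $u$ and $v$ with probability at most $8\rho_{uv}^4$.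 -/

import Mathlib

/-- A simple graph is planar if it can be drawn in the plane: vertices are distinct points, every
edge is a simple arc joining its two end points, the open arcs contain no vertex, and the open
arcs of distinct edges are disjoint. -/
def IsPlanar {V : Type*} (G : SimpleGraph V) : Prop :=
  ∃ (point : V → ℝ × ℝ) (arc : G.edgeSet → ℝ → ℝ × ℝ),
    Function.Injective point ∧
    (∀ e, ContinuousOn (arc e) (Set.Icc 0 1) ∧ Set.InjOn (arc e) (Set.Icc 0 1)) ∧
    (∀ e, s(arc e 0, arc e 1) = Sym2.map point (e : Sym2 V)) ∧
    (∀ e, ∀ t ∈ Set.Ioo (0 : ℝ) 1, ∀ x, arc e t ≠ point x) ∧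
    (∀ e f, e ≠ f → ∀ s ∈ Set.Ioo (0 : ℝ) 1, ∀ t ∈ Set.Ioo (0 : ℝ) 1, arc e s ≠ arc f t)

/-- A choice of BFS roots: for each phase `i`, each possible remaining graph `H = G \ F`, and each
connected component `C` of `H`, a vertex of `C`. -/
structure RootRule (V : Type*) where
  root : ℕ → (H : SimpleGraph V) → H.ConnectedComponent → V
  root_mem : ∀ i H C, root i H C ∈ C.supp

/-- The edges of the component `C` of `H` at level `l` of the BFS from `r`: one end point is at
distance `l` from `r` and the other at distance `l + 1`, distances being measured in `H`. -/
def edgesAtLevel {V : Type*} (H : SimpleGraph V) (C : H.ConnectedComponent) (r : V) (l : ℕ) :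
    Set (Sym2 V) :=
  {e | ∃ x y, e = s(x, y) ∧ H.Adj x y ∧ x ∈ C.supp ∧ H.dist r x = l ∧ H.dist r y = l + 1}

/-- The edges removed in one phase from the remaining graph `H`, when the component `C` uses the
root `r C` and the offset `k C`: all edges of `C` at a level congruent to `k C` modulo `R`. -/
def cutEdges {V : Type*} {R : ℕ} (H : SimpleGraph V) (r : H.ConnectedComponent → V)
    (k : H.ConnectedComponent → Fin R) : Set (Sym2 V) :=
  {e | ∃ (C : H.ConnectedComponent) (l : ℕ), l ≡ (k C : ℕ) [MOD R] ∧ e ∈ edgesAtLevel H C (r C) l}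

open Classical in
/-- One phase: every component of the remaining graph `H` draws an offset in `{0, …, R - 1}`,
uniformly and independently of the other components (that is, the family of offsets is uniform),
and the corresponding edges are removed. -/
noncomputable def kprPhase {V : Type*} [Fintype V] (R : ℕ) [NeZero R] (H : SimpleGraph V)
    (r : H.ConnectedComponent → V) : PMF (SimpleGraph V) :=
  letI : Fintype H.ConnectedComponent := Fintype.ofFinite _
  (PMF.uniformOfFintype (H.ConnectedComponent → Fin R)).map fun k =>
    H.deleteEdges (cutEdges H r k)

/-- The law of the remaining graph `G \ F` after `m` phases of the KPR decomposition of `G` with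
parameter `R`, the offsets of different phases being drawn independently. -/
noncomputable def kpr {V : Type*} [Fintype V] (R : ℕ) [NeZero R] (ρ : RootRule V)
    (G : SimpleGraph V) : ℕ → PMF (SimpleGraph V)
  | 0 => PMF.pure G
  | m + 1 => (kpr R ρ G m).bind fun H => kprPhase R H (ρ.root m H)

/-- The probability that `u` and `v` lie in different clusters, that is, in different connected
components of the remaining graph, after `m` phases of the KPR decomposition. -/
noncomputable def kprSepProb {V : Type*} [Fintype V] (R : ℕ) [NeZero R] (ρ : RootRule V)
    (G : SimpleGraph V) (m : ℕ) (u v : V) : ℝ :=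
  ((kpr R ρ G m).toOuterMeasure {H | ¬ H.Reachable u v}).toReal

/-! The graph is a cycle of length `3 d`, with two hubs joined to each cycle vertex by disjoint
paths of length `d`; a pendant path at the upper hub brings the number of vertices to `n`. The
vertices `u`, `v` sit at positions `d` and `2 d` of the cycle. The adversary chooses roots so that
four nested structures must be destroyed one after another: the paths to both hubs, the paths to one
hub, the whole cycle, and a walk of length at most `2 d` from `u` to `v`. A hub root cannot cut the
cycle, because all cycle vertices are at distance `d` from it; a bad offset ruins only one side.
Rooted at cycle vertex `0`, a bad offset cuts either inside the two arms to `u` and `v` or inside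
the arc between them, never both. Since `R > 2 d`, at most one level in the relevant range is cut in
each phase. A phase therefore loses at most one structure, with probability at most `2 d / R`, `d /
R`, `2 d / R`, `2 d / R` respectively. All four must be lost to separate `u` and `v`, and the
product is `8 (d / R) ^ 4`. The probabilistic part is `kpr_four_phases`, the geometric part
`bipyramidStage_step`, and planarity is shown by an explicit drawing. -/

/-! ### Probability of losing nested properties -/

open Classical in
theorem uniformOfFintype_pi_eval_mem {ι : Type*} [Fintype ι] (R : ℕ) [NeZero R] (i : ι)
    (B : Finset (Fin R)) (s : Set (ι → Fin R)) (hs : ∀ k ∈ s, k i ∈ B) :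
    (PMF.uniformOfFintype (ι → Fin R)).toOuterMeasure s ≤ (B.card : ENNReal) / R := by
  have hR : (R : ENNReal) ≠ 0 := by exact_mod_cast NeZero.ne R
  set P := Fintype.piFinset (fun j : ι => if j = i then B else Finset.univ) with hP
  have hsub : s ⊆ (P : Set (ι → Fin R)) := by
    intro k hk
    simp only [hP, Finset.mem_coe, Fintype.mem_piFinset]
    intro j
    by_cases h : j = i
    · subst h; simpa using hs k hk
    · simp [h]
  refine (MeasureTheory.measure_mono hsub).trans ?_
  rw [PMF.toOuterMeasure_uniformOfFintype_apply]
  have hc : P.card = B.card * R ^ (Fintype.card ι - 1) := by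
    rw [hP, Fintype.card_piFinset, ← Finset.mul_prod_erase _ _ (Finset.mem_univ i)]
    congr 1
    · simp
    · rw [Finset.prod_congr rfl (g := fun _ => R)]
      · simp [Finset.card_erase_of_mem]
      · intro j hj
        simp [Finset.ne_of_mem_erase hj]
  have hpos : 0 < Fintype.card ι := Fintype.card_pos_iff.mpr ⟨i⟩
  have ht : Fintype.card (ι → Fin R) = R * R ^ (Fintype.card ι - 1) := by
    rw [Fintype.card_fun, Fintype.card_fin, ← pow_succ', Nat.sub_add_cancel hpos]
  have hP' : Fintype.card (P : Set (ι → Fin R)) = P.card := by simp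
  rw [hP', hc, ht]
  push_cast
  rw [ENNReal.mul_div_mul_right]
  · exact pow_ne_zero _ hR
  · exact ENNReal.pow_ne_top (ENNReal.natCast_ne_top R)

/-- The bad event forces the single coordinate `k C` below `b`, which leaves at most `b` of its `R`
values. -/
theorem kprPhase_toOuterMeasure_le {V : Type*} [Fintype V] (R : ℕ) [NeZero R]
    (H : SimpleGraph V) (r : H.ConnectedComponent → V) (C : H.ConnectedComponent)
    (b : ℕ) (S : Set (SimpleGraph V))
    (h : ∀ k : H.ConnectedComponent → Fin R, b ≤ (k C : ℕ) → H.deleteEdges (cutEdges H r k) ∈ S) :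
    (kprPhase R H r).toOuterMeasure Sᶜ ≤ (b : ENNReal) / R := by
  classical
  unfold kprPhase
  let _ : Fintype H.ConnectedComponent := Fintype.ofFinite _
  rw [PMF.toOuterMeasure_map_apply]
  refine (uniformOfFintype_pi_eval_mem R C (Finset.univ.filter fun x : Fin R => (x : ℕ) < b) _
    ?_).trans ?_
  · intro k hk
    simp only [Finset.mem_filter, Finset.mem_univ, true_and]
    by_contra hb
    exact hk (h k (not_lt.mp hb))
  · gcongr
    refine (Finset.card_le_card_of_injOn (fun x : Fin R => (x : ℕ)) (t := Finset.range b)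
      ?_ ?_).trans (by simp)
    · intro x hx; simpa using hx
    · intro x _ y _ hxy; exact Fin.ext hxy

theorem kprPhase_support {V : Type*} [Fintype V] (R : ℕ) [NeZero R]
    (H : SimpleGraph V) (r : H.ConnectedComponent → V) (S : Set (SimpleGraph V))
    (h : ∀ k : H.ConnectedComponent → Fin R, H.deleteEdges (cutEdges H r k) ∈ S) :
    ∀ H' ∈ (kprPhase R H r).support, H' ∈ S := by
  intro H' hH'
  unfold kprPhase at hH'
  rw [PMF.support_map] at hH'
  obtain ⟨k, -, rfl⟩ := hH'
  exact h k

/-- If a phase started in `S` stays in `T'`, and a phase started in `T` ends outside `T'` with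
probability at most `b / R`, then the probability of being outside `S` is multiplied by at
most `b / R`. -/
theorem kpr_step {V : Type*} [Fintype V] (R : ℕ) [NeZero R] (ρ : RootRule V)
    (G : SimpleGraph V) (m : ℕ) (T S T' : Set (SimpleGraph V)) (q c : ENNReal)
    (hsupp : ∀ H ∈ (kpr R ρ G m).support, H ∈ T)
    (hq : (kpr R ρ G m).toOuterMeasure Sᶜ ≤ q)
    (hS : ∀ H ∈ S, ∀ H' ∈ (kprPhase R H (ρ.root m H)).support, H' ∈ T')
    (hT : ∀ H ∈ T, (kprPhase R H (ρ.root m H)).toOuterMeasure T'ᶜ ≤ c) :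
    (kpr R ρ G (m + 1)).toOuterMeasure T'ᶜ ≤ q * c := by
  classical
  rw [kpr, PMF.toOuterMeasure_bind_apply]
  calc _ ≤ ∑' H, (Sᶜ).indicator (kpr R ρ G m) H * c := by
        refine ENNReal.tsum_le_tsum fun H => ?_
        by_cases hH : H ∈ (kpr R ρ G m).support
        · by_cases hHS : H ∈ S
          · have : (kprPhase R H (ρ.root m H)).toOuterMeasure T'ᶜ = 0 := by
              rw [PMF.toOuterMeasure_apply_eq_zero_iff, Set.disjoint_left]
              intro H' h1 h2
              exact h2 (hS H hHS H' h1)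
            simp [this]
          · rw [Set.indicator_of_mem (by exact hHS)]
            gcongr
            exact hT H (hsupp H hH)
        · rw [PMF.mem_support_iff, not_not] at hH
          simp [hH]
    _ = (kpr R ρ G m).toOuterMeasure Sᶜ * c := by
        rw [ENNReal.tsum_mul_right, PMF.toOuterMeasure_apply]
    _ ≤ q * c := by gcongr

theorem kpr_support_succ {V : Type*} [Fintype V] (R : ℕ) [NeZero R] (ρ : RootRule V)
    (G : SimpleGraph V) (m : ℕ) (T T' : Set (SimpleGraph V))
    (hsupp : ∀ H ∈ (kpr R ρ G m).support, H ∈ T)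
    (hT : ∀ H ∈ T, ∀ H' ∈ (kprPhase R H (ρ.root m H)).support, H' ∈ T') :
    ∀ H ∈ (kpr R ρ G (m + 1)).support, H ∈ T' := by
  intro H' h
  rw [kpr, PMF.mem_support_bind_iff] at h
  obtain ⟨H, hH, h⟩ := h
  exact hT H (hsupp H hH) H' h

/-- Four nested properties, each of which can only be lost one at a time and with probability at
most `b / R` in one phase. -/
theorem kpr_four_phases {V : Type*} [Fintype V] (R : ℕ) [NeZero R] (ρ : RootRule V)
    (G : SimpleGraph V) (T : ℕ → Set (SimpleGraph V)) (b : ℕ → ℕ)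
    (hG : G ∈ T 4) (hT5 : T 5 = ∅) (hmono : ∀ j, T (j + 1) ⊆ T j)
    (hstep : ∀ m j, j < 4 → ∀ H ∈ T (j + 1), H ∉ T (j + 2) → ∃ C : H.ConnectedComponent,
      ∀ k : H.ConnectedComponent → Fin R,
        H.deleteEdges (cutEdges H (ρ.root m H) k) ∈ T j ∧
        (b (j + 1) ≤ (k C : ℕ) → H.deleteEdges (cutEdges H (ρ.root m H) k) ∈ T (j + 1))) :
    (kpr R ρ G 4).toOuterMeasure (T 1)ᶜ ≤
      ((b 4 : ENNReal) / R) * (b 3 / R) * (b 2 / R) * (b 1 / R) := by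
  -- `hstep` speaks only of the highest stage that `H` satisfies. Lower stages inherit the claim
  -- from above: if `H ∈ T (j + 2)`, the phase ends in `T (j + 1) ⊆ T j`.
  have hs : ∀ m j, j ≤ 4 → ∀ H ∈ T (j + 1), ∀ k : H.ConnectedComponent → Fin R,
      H.deleteEdges (cutEdges H (ρ.root m H) k) ∈ T j := by
    intro m j hj
    induction hj using Nat.decreasingInduction with
    | self => simp [hT5]
    | of_succ j hj ih =>
      intro H hH k
      by_cases h2 : H ∈ T (j + 2)
      · exact hmono j (ih H h2 k)
      · obtain ⟨C, hC⟩ := hstep m j hj H hH h2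
        exact (hC k).1
  have hp : ∀ m j, j < 4 → ∀ H ∈ T (j + 1),
      (kprPhase R H (ρ.root m H)).toOuterMeasure (T (j + 1))ᶜ ≤ (b (j + 1) : ENNReal) / R := by
    intro m j hj H hH
    by_cases h2 : H ∈ T (j + 2)
    · have h0 : (kprPhase R H (ρ.root m H)).toOuterMeasure (T (j + 1))ᶜ = 0 := by
        rw [PMF.toOuterMeasure_apply_eq_zero_iff, Set.disjoint_left]
        intro H' h1 h3
        exact h3 (kprPhase_support R H _ _ (hs m (j + 1) (by omega) H h2) H' h1)
      rw [h0]
      exact zero_le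
    · obtain ⟨C, hC⟩ := hstep m j hj H hH h2
      exact kprPhase_toOuterMeasure_le R H _ C _ _ fun k => (hC k).2
  have hs' : ∀ m j, j < 4 → ∀ H ∈ T (j + 1), ∀ H' ∈ (kprPhase R H (ρ.root m H)).support,
      H' ∈ T j := fun m j hj H hH => kprPhase_support R H _ _ (hs m j hj.le H hH)
  have s0 : ∀ H ∈ (kpr R ρ G 0).support, H ∈ T 4 := by
    intro H hH
    rw [kpr, PMF.support_pure] at hH
    rw [Set.mem_singleton_iff.mp hH]; exact hG
  have s1 := kpr_support_succ R ρ G 0 _ _ s0 (hs' 0 3 (by norm_num))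
  have s2 := kpr_support_succ R ρ G 1 _ _ s1 (hs' 1 2 (by norm_num))
  have s3 := kpr_support_succ R ρ G 2 _ _ s2 (hs' 2 1 (by norm_num))
  -- The empty stage above `T 4` starts the recursion, with the trivial bound `1`.
  have q0 : (kpr R ρ G 0).toOuterMeasure (∅ : Set (SimpleGraph V))ᶜ ≤ 1 := by
    rw [(PMF.toOuterMeasure_apply_eq_one_iff _ _).mpr (by simp)]
  have q1 : (kpr R ρ G 1).toOuterMeasure (T 4)ᶜ ≤ 1 * ((b 4 : ENNReal) / R) :=
    kpr_step R ρ G 0 _ ∅ _ 1 _ s0 q0 (by simp) (hp 0 3 (by norm_num))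
  have q2 := kpr_step R ρ G 1 _ _ _ _ _ s1 q1 (hs' 1 3 (by norm_num)) (hp 1 2 (by norm_num))
  have q3 := kpr_step R ρ G 2 _ _ _ _ _ s2 q2 (hs' 2 2 (by norm_num)) (hp 2 1 (by norm_num))
  have q4 := kpr_step R ρ G 3 _ _ _ _ _ s3 q3 (hs' 3 1 (by norm_num)) (hp 3 0 (by norm_num))
  simpa only [one_mul] using q4

/-! ### Exact distances from potentials, and edges that survive a phase -/

theorem exists_walk_of_descent {V : Type*} (H : SimpleGraph V) (r : V) (f : V → ℤ) (S : Set V)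
    (hpos : ∀ y ∈ S, 0 ≤ f y) (h0 : ∀ y ∈ S, f y = 0 → y = r)
    (hS : ∀ y ∈ S, f y ≠ 0 → ∃ z ∈ S, H.Adj z y ∧ f z + 1 = f y) :
    ∀ y ∈ S, ∃ p : H.Walk r y, (p.length : ℤ) = f y := by
  have key : ∀ n : ℕ, ∀ y ∈ S, f y = n → ∃ p : H.Walk r y, p.length = n := by
    intro n
    induction n with
    | zero =>
      intro y hy hf
      obtain rfl := h0 y hy hf
      exact ⟨.nil, rfl⟩
    | succ n ih =>
      intro y hy hf
      obtain ⟨z, hz, hzy, hfz⟩ := hS y hy (by omega)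
      obtain ⟨p, hp⟩ := ih z hz (by omega)
      exact ⟨p.concat hzy, by simp [hp]⟩
  intro y hy
  obtain ⟨p, hp⟩ := key (f y).toNat y hy (by have := hpos y hy; omega)
  exact ⟨p, by have := hpos y hy; omega⟩

theorem le_add_length_of_lipschitz {V : Type*} {H : SimpleGraph V} (f : V → ℤ)
    (hf : ∀ x y, H.Adj x y → f y ≤ f x + 1) {x y : V} (p : H.Walk x y) :
    f y ≤ f x + p.length := by
  induction p with
  | nil => simp
  | cons h p ih =>
    have := hf _ _ h
    simp only [SimpleGraph.Walk.length_cons, Nat.cast_add, Nat.cast_one]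
    omega

/-- A potential growing by at most one along edges bounds distances from below. A potential that is
Lipschitz on the full graph stays so on every subgraph, so distances in `H` are known exactly even
where the other edges of `H` are unknown; the matching walk comes from `exists_walk_of_descent`. -/
theorem dist_eq_of_walk_of_lipschitz {V : Type*} {H : SimpleGraph V} (f : V → ℤ)
    (hf : ∀ x y, H.Adj x y → f y ≤ f x + 1) {r y : V} (hr : f r = 0) (p : H.Walk r y)
    (hp : (p.length : ℤ) = f y) : (H.dist r y : ℤ) = f y := by
  obtain ⟨q, hq⟩ := p.reachable.exists_walk_length_eq_dist
  have h1 := le_add_length_of_lipschitz f hf q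
  have h2 := SimpleGraph.dist_le p
  omega

/-- An edge is cut only if the offset is congruent to the distance of its nearer end point. Here
levels are below `R`, so congruence is equality, and `hlt` says that an end point at distance equal
to the offset is never strictly nearer. -/
theorem adj_deleteEdges_cutEdges {V : Type*} {R : ℕ} {H : SimpleGraph V}
    {r : H.ConnectedComponent → V} {k : H.ConnectedComponent → Fin R} {a x y : V}
    (hr : r (H.connectedComponentMk a) = a) (hax : H.Reachable a x) (hxy : H.Adj x y)
    (hlt : ∀ z ∈ ({x, y} : Set V), (k (H.connectedComponentMk a) : ℕ) = H.dist a z →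
      H.dist a x ≤ H.dist a z ∧ H.dist a y ≤ H.dist a z)
    (hR : H.dist a x ≤ R ∧ H.dist a y ≤ R) :
    (H.deleteEdges (cutEdges H r k)).Adj x y := by
  rw [SimpleGraph.deleteEdges_adj]
  refine ⟨hxy, ?_⟩
  rintro ⟨C, l, hl, x', y', he, -, hx', h1, h2⟩
  have hay : H.Reachable a y := hax.trans hxy.reachable
  have hC : C = H.connectedComponentMk a := by
    rw [SimpleGraph.ConnectedComponent.mem_supp_iff] at hx'
    rw [← hx', SimpleGraph.ConnectedComponent.eq]
    rcases Sym2.eq_iff.mp he with ⟨rfl, rfl⟩ | ⟨rfl, rfl⟩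
    · exact hax.symm
    · exact hay.symm
  subst hC
  rw [hr] at h1 h2
  have hk := (k (H.connectedComponentMk a)).isLt
  have hlR : l < R := by
    rcases Sym2.eq_iff.mp he with ⟨rfl, rfl⟩ | ⟨rfl, rfl⟩ <;> omega
  rw [Nat.ModEq, Nat.mod_eq_of_lt hlR, Nat.mod_eq_of_lt hk] at hl
  rcases Sym2.eq_iff.mp he with ⟨rfl, rfl⟩ | ⟨rfl, rfl⟩
  · have := hlt x (by simp) (by omega)
    omega
  · have := hlt y (by simp) (by omega)
    omega

open Classical in
/-- The rule that uses the vertex `pref H` as the root of its component of `H` and arbitrary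
roots elsewhere. -/
noncomputable def RootRule.ofPreferred {V : Type*} (pref : SimpleGraph V → V) : RootRule V where
  root _ H C := if pref H ∈ C.supp then pref H else C.nonempty_supp.some
  root_mem _ H C := by
    split_ifs with h
    · exact h
    · exact C.nonempty_supp.some_mem

theorem RootRule.ofPreferred_root {V : Type*} (pref : SimpleGraph V → V) (m : ℕ)
    (H : SimpleGraph V) :
    (RootRule.ofPreferred pref).root m H (H.connectedComponentMk (pref H)) = pref H := by
  simp [RootRule.ofPreferred]

/-- A short walk from the root survives a phase whose offset is large. -/
theorem exists_walk_deleteEdges_cutEdges {V : Type*} {R : ℕ} {H : SimpleGraph V}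
    {r : H.ConnectedComponent → V} {k : H.ConnectedComponent → Fin R} {a b : V} {D : ℕ}
    (hr : r (H.connectedComponentMk a) = a) (p : H.Walk a b) (hp : p.length ≤ D)
    (hk : D ≤ (k (H.connectedComponentMk a) : ℕ)) :
    ∃ q : (H.deleteEdges (cutEdges H r k)).Walk a b, q.length ≤ D := by
  have hkR := (k (H.connectedComponentMk a)).isLt
  have hb := (SimpleGraph.dist_le p).trans hp
  obtain ⟨q, hq⟩ := exists_walk_of_descent (H.deleteEdges (cutEdges H r k)) a
    (fun y => (H.dist a y : ℤ)) {y | H.Reachable a y ∧ H.dist a y ≤ D} (fun y _ => by positivity)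
    (fun y hy h => ((hy.1.dist_eq_zero_iff).mp (by exact_mod_cast h)).symm) (by
      rintro y ⟨hy, hyD⟩ hne
      have hne' : H.dist a y ≠ 0 := by exact_mod_cast hne
      obtain ⟨w, hw⟩ := hy.symm.exists_walk_length_eq_dist
      cases w with
      | nil => simp at hne'
      | @cons _ z _ hyz w =>
        have h1 : H.dist a z ≤ w.length := by
          rw [SimpleGraph.dist_comm]; exact SimpleGraph.dist_le w
        have hz : H.Reachable a z := w.reachable.symm
        rw [SimpleGraph.Walk.length_cons, SimpleGraph.dist_comm] at hw
        obtain ⟨w', hw'⟩ := hz.exists_walk_length_eq_dist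
        have h2 := SimpleGraph.dist_le (w'.concat hyz.symm)
        rw [SimpleGraph.Walk.length_concat] at h2
        refine ⟨z, ⟨hz, by omega⟩, adj_deleteEdges_cutEdges hr hz hyz.symm ?_ ⟨by omega, by omega⟩,
          by push_cast [← hw, hw']; omega⟩
        rintro t (rfl | rfl) ht <;> omega) b ⟨p.reachable, hb⟩
  exact ⟨q, by omega⟩

/-! ### The bipyramid graph -/

/-- The vertices: `2 d - 1` rows of `3 d` points, a hub below, a hub above, and a column of
points above the upper hub, up to height `T`. -/
noncomputable def bipyramidCells (d : ℕ) (T : ℤ) : Finset (ℤ × ℤ) :=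
  Finset.Ico (0 : ℤ) (3 * d) ×ˢ Finset.Ioo (-d : ℤ) d ∪ {0} ×ˢ insert (-d : ℤ) (Finset.Icc (d : ℤ) T)

theorem mem_bipyramidCells {d : ℕ} {T i j : ℤ} : (i, j) ∈ bipyramidCells d T ↔
    (0 ≤ i ∧ i < 3 * d ∧ -d < j ∧ j < d) ∨ (i = 0 ∧ (j = -d ∨ (d ≤ j ∧ j ≤ T))) := by
  simp [bipyramidCells]
  omega

/-- The upward and rightward oriented edges: vertical edges, the edges from the outer rows to the
hubs, and the cycle of length `3 d` on row `0`. -/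
def BipyramidStep (d : ℕ) (p q : ℤ × ℤ) : Prop :=
  (q.2 = p.2 + 1 ∧ (p.1 = q.1 ∨ (q.2 = d ∧ q.1 = 0) ∨ (p.2 = -d ∧ p.1 = 0))) ∨
  (p.2 = 0 ∧ q.2 = 0 ∧ q.1 = p.1 + 1) ∨
  (p.2 = 0 ∧ q.2 = 0 ∧ p.1 = 0 ∧ q.1 = 3 * d - 1)

/-- A cycle of length `3 d` with two hubs, each joined to every vertex of the cycle by a path of
length `d`, these paths being disjoint, and a path attached to the upper hub. -/
def bipyramid (d : ℕ) (T : ℤ) : SimpleGraph (bipyramidCells d T) where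
  Adj p q := BipyramidStep d p q ∨ BipyramidStep d q p
  symm := ⟨fun _ _ h => h.symm⟩
  loopless := ⟨by
    rintro ⟨⟨i, j⟩, h⟩
    simp only [BipyramidStep]
    omega⟩

theorem bipyramid_adj {d : ℕ} {T : ℤ} {p q : bipyramidCells d T} :
    (bipyramid d T).Adj p q ↔ BipyramidStep d p q ∨ BipyramidStep d q p := Iff.rfl

theorem bipyramid_adj_mk {d : ℕ} {T i j i' j' : ℤ} {h : (i, j) ∈ bipyramidCells d T}
    {h' : (i', j') ∈ bipyramidCells d T} : (bipyramid d T).Adj ⟨(i, j), h⟩ ⟨(i', j'), h'⟩ ↔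
      ((j' = j + 1 ∧ (i = i' ∨ (j' = d ∧ i' = 0) ∨ (j = -d ∧ i = 0))) ∨
        (j = 0 ∧ j' = 0 ∧ i' = i + 1) ∨ (j = 0 ∧ j' = 0 ∧ i = 0 ∧ i' = 3 * d - 1)) ∨
      ((j = j' + 1 ∧ (i' = i ∨ (j = d ∧ i = 0) ∨ (j' = -d ∧ i' = 0))) ∨
        (j' = 0 ∧ j = 0 ∧ i = i' + 1) ∨ (j' = 0 ∧ j = 0 ∧ i' = 0 ∧ i = 3 * d - 1)) := Iff.rfl

theorem card_bipyramidCells {d : ℕ} {T : ℤ} (hT : d ≤ T) (hd : 1 ≤ d) :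
    ((bipyramidCells d T).card : ℤ) = 3 * d * (2 * d - 1) + (T - d + 2) := by
  rw [bipyramidCells, Finset.card_union_of_disjoint, Finset.card_product, Finset.card_product,
    Finset.card_insert_of_notMem]
  · simp only [Int.card_Ico, Int.card_Ioo, Int.card_Icc, Finset.card_singleton]
    push_cast
    rw [Int.toNat_of_nonneg (by omega), Int.toNat_of_nonneg (by omega),
      Int.toNat_of_nonneg (by omega)]
    ring
  · simp; omega
  · rw [Finset.disjoint_left]
    rintro ⟨i, j⟩
    simp
    omega

/-- `H` contains all edges of `G` between vertices of the rows `a, …, b`. -/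
def ContainsRows {s : Finset (ℤ × ℤ)} (G H : SimpleGraph s) (a b : ℤ) : Prop :=
  ∀ p q, G.Adj p q → a ≤ p.1.2 → p.1.2 ≤ b → a ≤ q.1.2 → q.1.2 ≤ b → H.Adj p q

theorem ContainsRows.mono {s : Finset (ℤ × ℤ)} {G H : SimpleGraph s} {a b a' b' : ℤ}
    (h : ContainsRows G H a b) (ha : a ≤ a') (hb : b' ≤ b) : ContainsRows G H a' b' :=
  fun p q hpq h1 h2 h3 h4 => h p q hpq (ha.trans h1) (h2.trans hb) (ha.trans h3) (h4.trans hb)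

/-! ### Phases rooted at a hub -/

section Hub

variable {d : ℕ} {T : ℤ}

/-- The hub in row `h`, which is `d` or `-d`. -/
def bipyramidHub (hT : d ≤ T) (h : ℤ) (hh : h = d ∨ h = -d) : bipyramidCells d T :=
  ⟨(0, h), mem_bipyramidCells.mpr (by omega)⟩

theorem bipyramid_hub_descent (hd : 1 ≤ d) (hT : d ≤ T) {h : ℤ} (hh : h = d ∨ h = -d)
    (y : bipyramidCells d T) (hy : y.1.2 ≠ h) :
    ∃ z, (bipyramid d T).Adj z y ∧
      max (h - z.1.2) (z.1.2 - h) + 1 = max (h - y.1.2) (y.1.2 - h) ∧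
      min h y.1.2 ≤ z.1.2 ∧ z.1.2 ≤ max h y.1.2 := by
  obtain ⟨⟨i, j⟩, hy'⟩ := y
  rw [mem_bipyramidCells] at hy'
  simp only at hy ⊢
  rcases lt_or_gt_of_ne hy with hlt | hlt
  · by_cases hj : j + 1 = d
    · exact ⟨⟨(0, j + 1), mem_bipyramidCells.mpr (by omega)⟩, bipyramid_adj_mk.mpr (by omega),
        by simp only; omega⟩
    · exact ⟨⟨(i, j + 1), mem_bipyramidCells.mpr (by omega)⟩, bipyramid_adj_mk.mpr (by omega),
        by simp only; omega⟩
  · by_cases hj : j - 1 = -d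
    · exact ⟨⟨(0, j - 1), mem_bipyramidCells.mpr (by omega)⟩, bipyramid_adj_mk.mpr (by omega),
        by simp only; omega⟩
    · exact ⟨⟨(i, j - 1), mem_bipyramidCells.mpr (by omega)⟩, bipyramid_adj_mk.mpr (by omega),
        by simp only; omega⟩

/-- No edge changes the row by more than one, so the row difference is a lower bound. The descent
towards the hub stays between the row of `y` and row `h`, where `H` is complete. -/
theorem bipyramid_hub_dist (hd : 1 ≤ d) (hT : d ≤ T) {h : ℤ} (hh : h = d ∨ h = -d)
    {H : SimpleGraph (bipyramidCells d T)} (hHG : H ≤ bipyramid d T) {a b : ℤ}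
    (hH : ContainsRows (bipyramid d T) H a b) (ha : a ≤ h) (hb : h ≤ b)
    (y : bipyramidCells d T) (hay : a ≤ y.1.2) (hyb : y.1.2 ≤ b) :
    H.Reachable (bipyramidHub hT h hh) y ∧
      (H.dist (bipyramidHub hT h hh) y : ℤ) = max (h - y.1.2) (y.1.2 - h) := by
  obtain ⟨p, hp⟩ := exists_walk_of_descent H (bipyramidHub hT h hh)
    (fun y => max (h - y.1.2) (y.1.2 - h)) {y | a ≤ y.1.2 ∧ y.1.2 ≤ b}
    (fun y _ => by omega) (by
      rintro ⟨⟨i, j⟩, hy⟩ _ h0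
      rw [mem_bipyramidCells] at hy
      simp only at h0
      simp only [bipyramidHub, Subtype.mk.injEq, Prod.mk.injEq]
      omega) (by
      rintro y ⟨h1, h2⟩ h0
      obtain ⟨z, hzy, hz, hz1, hz2⟩ := bipyramid_hub_descent hd hT hh y (by omega)
      have h3 : a ≤ z.1.2 ∧ z.1.2 ≤ b := by omega
      exact ⟨z, h3, hH z y hzy h3.1 h3.2 h1 h2, hz⟩) y ⟨hay, hyb⟩
  refine ⟨p.reachable, dist_eq_of_walk_of_lipschitz (fun y => max (h - y.1.2) (y.1.2 - h)) ?_
    (by simp [bipyramidHub]) p hp⟩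
  intro x y hxy
  have := bipyramid_adj.mp (hHG hxy)
  simp only [BipyramidStep] at this
  omega

theorem bipyramid_connected (hd : 1 ≤ d) (hT : d ≤ T) : (bipyramid d T).Connected := by
  rw [SimpleGraph.connected_iff_exists_forall_reachable]
  refine ⟨bipyramidHub hT d (.inl rfl), fun y => ?_⟩
  exact (bipyramid_hub_dist hd hT (.inl rfl) le_rfl (a := min (-d) y.1.2) (b := max d y.1.2)
    (fun p q h _ _ _ _ => h) (by omega) (by omega) y (by omega) (by omega)).1

/-- The rows `a', …, b'` survive a phase rooted at a hub unless the offset is the distance from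
the hub of one of these rows to the next. -/
theorem ContainsRows.deleteEdges_of_hub (hd : 1 ≤ d) (hT : d ≤ T) {h : ℤ} (hh : h = d ∨ h = -d)
    {H : SimpleGraph (bipyramidCells d T)} (hHG : H ≤ bipyramid d T) {a b : ℤ}
    (hH : ContainsRows (bipyramid d T) H a b) (ha : a ≤ h) (hb : h ≤ b) {R : ℕ} (hR : 2 * d < R)
    {r : H.ConnectedComponent → bipyramidCells d T} (k : H.ConnectedComponent → Fin R)
    (hr : r (H.connectedComponentMk (bipyramidHub hT h hh)) = bipyramidHub hT h hh)
    {a' b' : ℤ} (haa : a ≤ a') (hbb : b' ≤ b) (hda : -d ≤ a') (hdb : b' ≤ d)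
    (hk : ∀ j, a' ≤ j → j ≤ b' →
      ((k (H.connectedComponentMk (bipyramidHub hT h hh)) : ℕ) : ℤ) = max (h - j) (j - h) →
      max (h - a') (a' - h) ≤ max (h - j) (j - h) ∧
      max (h - b') (b' - h) ≤ max (h - j) (j - h)) :
    ContainsRows (bipyramid d T) (H.deleteEdges (cutEdges H r k)) a' b' := by
  intro p q hpq h1 h2 h3 h4
  obtain ⟨hp1, hp2⟩ := bipyramid_hub_dist hd hT hh hHG hH ha hb p (by omega) (by omega)
  obtain ⟨hq1, hq2⟩ := bipyramid_hub_dist hd hT hh hHG hH ha hb q (by omega) (by omega)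
  refine adj_deleteEdges_cutEdges hr hp1 (hH p q hpq (by omega) (by omega) (by omega) (by omega))
    ?_ ⟨by omega, by omega⟩
  rintro z (rfl | rfl) hz
  · have := hk z.1.2 h1 h2 (by omega)
    omega
  · have := hk z.1.2 h3 h4 (by omega)
    omega

end Hub

/-! ### Distances along the cycle -/

section Cycle

variable {d : ℕ} {T : ℤ}

/-- The vertex `i` of the cycle on row `0`. -/
def bipyramidCycle (hd : 1 ≤ d) (i : ℤ) (hi : 0 ≤ i ∧ i < 3 * d) : bipyramidCells d T :=
  ⟨(i, 0), mem_bipyramidCells.mpr (by omega)⟩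

theorem bipyramidCycle_coe (hd : 1 ≤ d) (i : ℤ) (hi : 0 ≤ i ∧ i < 3 * d) :
    (bipyramidCycle (T := T) hd i hi).1 = (i, 0) := rfl

/-- The distance from the vertex `0` on the cycle of length `3 d`. -/
def cycleDist (d : ℕ) (i : ℤ) : ℤ := min i (3 * d - i)

theorem exists_walk_cycle (hd : 1 ≤ d) {H : SimpleGraph (bipyramidCells d T)} {m : ℤ}
    (hH : ∀ p q, (bipyramid d T).Adj p q → p.1.2 = 0 → q.1.2 = 0 → cycleDist d p.1.1 ≤ m →
      cycleDist d q.1.1 ≤ m → H.Adj p q)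
    (y : bipyramidCells d T) (hy : y.1.2 = 0) (hym : cycleDist d y.1.1 ≤ m) :
    ∃ p : H.Walk (bipyramidCycle hd 0 (by omega)) y, (p.length : ℤ) = cycleDist d y.1.1 := by
  refine exists_walk_of_descent H _ (fun y => cycleDist d y.1.1)
    {y | y.1.2 = 0 ∧ cycleDist d y.1.1 ≤ m} ?_ ?_ ?_ y ⟨hy, hym⟩
  · rintro ⟨⟨i, j⟩, hy⟩ _
    rw [mem_bipyramidCells] at hy
    simp only [cycleDist]
    omega
  · rintro ⟨⟨i, j⟩, hy⟩ ⟨h1, -⟩ h0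
    rw [mem_bipyramidCells] at hy
    simp only [cycleDist] at h0 h1
    simp only [bipyramidCycle, Subtype.mk.injEq, Prod.mk.injEq]
    omega
  · rintro ⟨⟨i, j⟩, hy⟩ ⟨h1, h2⟩ h0
    have hy' := mem_bipyramidCells.mp hy
    simp only [cycleDist] at h0 h1 h2
    have key : ∀ i' : ℤ, ∀ h' : (i', j) ∈ bipyramidCells d T,
        (bipyramid d T).Adj ⟨(i', j), h'⟩ ⟨(i, j), hy⟩ →
        cycleDist d i' + 1 = cycleDist d i →
        ∃ z ∈ {y : bipyramidCells d T | y.1.2 = 0 ∧ cycleDist d y.1.1 ≤ m},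
          H.Adj z ⟨(i, j), hy⟩ ∧ cycleDist d z.1.1 + 1 = cycleDist d i := by
      intro i' h' hs hc
      simp only [cycleDist] at hc
      have hm : cycleDist d i' ≤ m := by simp only [cycleDist]; omega
      exact ⟨⟨(i', j), h'⟩, ⟨h1, hm⟩, hH _ _ hs h1 h1 hm h2, hc⟩
    by_cases hi : i ≤ 3 * d - i
    · exact key (i - 1) (mem_bipyramidCells.mpr (by omega)) (bipyramid_adj_mk.mpr (by omega))
        (by simp only [cycleDist]; omega)
    · by_cases hi' : i = 3 * d - 1
      · exact key 0 (mem_bipyramidCells.mpr (by omega)) (bipyramid_adj_mk.mpr (by omega))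
          (by simp only [cycleDist]; omega)
      · exact key (i + 1) (mem_bipyramidCells.mpr (by omega))
          (bipyramid_adj_mk.mpr (by omega)) (by simp only [cycleDist]; omega)

theorem bipyramid_cycle_dist (hd : 1 ≤ d) {H : SimpleGraph (bipyramidCells d T)}
    (hHG : H ≤ bipyramid d T) (hH : ContainsRows (bipyramid d T) H 0 0)
    (y : bipyramidCells d T) (hy : y.1.2 = 0) :
    H.Reachable (bipyramidCycle hd 0 (by omega)) y ∧
      (H.dist (bipyramidCycle hd 0 (by omega)) y : ℤ) = cycleDist d y.1.1 := by
  obtain ⟨p, hp⟩ := exists_walk_cycle hd (m := cycleDist d y.1.1) (H := H)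
    (fun p q hpq h1 h2 _ _ => hH p q hpq h1.ge h1.le h2.ge h2.le) y hy le_rfl
  refine ⟨p.reachable, ?_⟩
  -- A detour over a hub has length `2 d`, while the cycle has diameter at most `3 d / 2`. The
  -- potential encodes this: it is `cycleDist` on row `0`, and the paths of all columns bring it to
  -- the common value `d` at the hubs.
  set f : bipyramidCells d T → ℤ := fun y =>
    max (max y.1.2 (-y.1.2)) (min (cycleDist d y.1.1) (2 * d - max y.1.2 (-y.1.2))) with hf
  have hfy : f y = cycleDist d y.1.1 := by
    obtain ⟨⟨i, j⟩, hy'⟩ := y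
    rw [mem_bipyramidCells] at hy'
    simp only [hf, cycleDist] at hy ⊢
    omega
  rw [← hfy]
  refine dist_eq_of_walk_of_lipschitz f ?_ (by simp [hf, bipyramidCycle, cycleDist]) p
    (by rw [hp, hfy])
  rintro ⟨⟨i, j⟩, hx⟩ ⟨⟨i', j'⟩, hy⟩ hxy
  have := bipyramid_adj.mp (hHG hxy)
  rw [mem_bipyramidCells] at hx hy
  simp only [BipyramidStep, hf, cycleDist] at this ⊢
  omega

theorem exists_walk_segment (hd : 1 ≤ d) {H : SimpleGraph (bipyramidCells d T)}
    (hH : ∀ p q, (bipyramid d T).Adj p q → p.1.2 = 0 → q.1.2 = 0 → d ≤ p.1.1 → p.1.1 ≤ 2 * d →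
      d ≤ q.1.1 → q.1.1 ≤ 2 * d → H.Adj p q) :
    ∃ p : H.Walk (bipyramidCycle hd d (by omega)) (bipyramidCycle hd (2 * d) (by omega)),
      p.length = d := by
  obtain ⟨p, hp⟩ := exists_walk_of_descent H (bipyramidCycle hd d (by omega))
    (fun y => y.1.1 - d) {y | y.1.2 = 0 ∧ d ≤ y.1.1 ∧ y.1.1 ≤ 2 * d}
    (fun y hy => by have := hy.2.1; omega) (by
      rintro ⟨⟨i, j⟩, hy⟩ ⟨h1, h2, h3⟩ h0
      simp only at h0 h1
      simp only [bipyramidCycle, Subtype.mk.injEq, Prod.mk.injEq]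
      omega) (by
      rintro ⟨⟨i, j⟩, hy⟩ ⟨h1, h2, h3⟩ h0
      simp only at h0 h1 h2 h3
      have hz : (i - 1, j) ∈ bipyramidCells d T := mem_bipyramidCells.mpr (by omega)
      refine ⟨⟨(i - 1, j), hz⟩, ⟨h1, by simp only; omega, by simp only; omega⟩, ?_,
        by simp only; omega⟩
      exact hH ⟨(i - 1, j), hz⟩ ⟨(i, j), hy⟩ (bipyramid_adj_mk.mpr (by omega))
        h1 h1 (by simp only; omega) (by simp only; omega) h2 h3)
    (bipyramidCycle hd (2 * d) (by omega))
    ⟨rfl, by simp only [bipyramidCycle_coe]; omega, by simp only [bipyramidCycle_coe]; omega⟩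
  refine ⟨p, ?_⟩
  simp only [bipyramidCycle_coe] at hp ⊢
  omega

theorem bipyramid_dist (hd : 1 ≤ d) :
    (bipyramid d T).dist (bipyramidCycle hd d (by omega))
      (bipyramidCycle hd (2 * d) (by omega)) = d := by
  obtain ⟨p, hp⟩ := exists_walk_segment (T := T) hd (H := bipyramid d T)
    (fun p q h _ _ _ _ _ _ => h)
  have hv : max (min (max ((2 * d : ℤ) - d) (d - 2 * d)) d) (max 0 (-0)) = d := by
    rw [max_eq_left (a := (2 * d : ℤ) - d) (by omega)]
    omega
  have := dist_eq_of_walk_of_lipschitz (H := bipyramid d T)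
    -- The horizontal distance from column `d`, capped at `d`, combined with the height: the cap
    -- makes the closing edge of the cycle harmless, and both hubs get value `d`.
    (fun y => max (min (max (y.1.1 - d) (d - y.1.1)) d) (max y.1.2 (-y.1.2))) ?_
    (by simp [bipyramidCycle]) p (by simp only [bipyramidCycle_coe]; rw [hp, hv])
  · simp only [bipyramidCycle_coe] at this ⊢
    rw [hv] at this
    exact_mod_cast this
  · rintro ⟨⟨i, j⟩, hx⟩ ⟨⟨i', j'⟩, hy⟩ hxy
    have := bipyramid_adj.mp hxy
    rw [mem_bipyramidCells] at hx hy
    simp only [BipyramidStep] at this ⊢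
    omega

end Cycle

/-! ### The four stages and the adversarial roots -/

section Stages

variable {d : ℕ} {T : ℤ}

/-- Nested properties of a remaining graph: a short walk from `d` to `2 d` on the cycle, the whole
cycle, the cycle with all paths to one hub, the cycle with all paths to both hubs. -/
def bipyramidStage (hd : 1 ≤ d) (T : ℤ) : ℕ → Set (SimpleGraph (bipyramidCells d T))
  | 0 => Set.univ
  | 1 => {H | H ≤ bipyramid d T ∧ ∃ p : H.Walk (bipyramidCycle hd d (by omega))
      (bipyramidCycle hd (2 * d) (by omega)), p.length ≤ 2 * d}
  | 2 => {H | H ≤ bipyramid d T ∧ ContainsRows (bipyramid d T) H 0 0}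
  | 3 => {H | H ≤ bipyramid d T ∧ (ContainsRows (bipyramid d T) H 0 d ∨
      ContainsRows (bipyramid d T) H (-d) 0)}
  | 4 => {H | H ≤ bipyramid d T ∧ ContainsRows (bipyramid d T) H (-d) d}
  | _ => ∅

theorem exists_walk_of_containsRows_zero (hd : 1 ≤ d) {H : SimpleGraph (bipyramidCells d T)}
    (h : ContainsRows (bipyramid d T) H 0 0) :
    ∃ p : H.Walk (bipyramidCycle hd d (by omega)) (bipyramidCycle hd (2 * d) (by omega)),
      p.length ≤ 2 * d := by
  obtain ⟨p, hp⟩ := exists_walk_segment (H := H) hd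
    (fun p q hpq h1 h2 _ _ _ _ => h p q hpq h1.ge h1.le h2.ge h2.le)
  exact ⟨p, by omega⟩

theorem bipyramidStage_succ_subset (hd : 1 ≤ d) (j : ℕ) :
    bipyramidStage hd T (j + 1) ⊆ bipyramidStage hd T j := by
  intro H hH
  match j, hH with
  | 0, _ => trivial
  | 1, h => exact ⟨h.1, exists_walk_of_containsRows_zero hd h.2⟩
  | 2, h => exact ⟨h.1, h.2.elim (fun h => h.mono le_rfl (by omega))
      (fun h => h.mono (by omega) le_rfl)⟩
  | 3, h => exact ⟨h.1, .inl (h.2.mono (by omega) le_rfl)⟩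

open Classical in
/-- The root: a hub with all its paths, or else the vertex `0` of a complete cycle, or else the
vertex `d` of the cycle. -/
noncomputable def bipyramidRoot (hd : 1 ≤ d) (hT : d ≤ T)
    (H : SimpleGraph (bipyramidCells d T)) : bipyramidCells d T :=
  if ContainsRows (bipyramid d T) H 0 d then bipyramidHub hT d (.inl rfl)
  else if ContainsRows (bipyramid d T) H (-d) 0 then bipyramidHub hT (-d) (.inr rfl)
  else if ContainsRows (bipyramid d T) H 0 0 then bipyramidCycle hd 0 (by omega)
  else bipyramidCycle hd d (by omega)

/-- The number of offsets that destroy a stage. -/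
def bipyramidLoss (d : ℕ) (j : ℕ) : ℕ := if j = 3 then d else 2 * d

variable {R : ℕ}

/-- Between the hubs the levels from the upper hub are `0, …, 2 d - 1`, and at most one is cut. An
offset below `d` cuts above the cycle and spares the lower half; any other offset spares the upper
half. -/
theorem bipyramidStage_four_step (hd : 1 ≤ d) (hT : d ≤ T) (hR : 2 * d < R)
    {H : SimpleGraph (bipyramidCells d T)} (hH : H ∈ bipyramidStage hd T 4)
    {r : H.ConnectedComponent → bipyramidCells d T} (k : H.ConnectedComponent → Fin R)
    (hr : r (H.connectedComponentMk (bipyramidHub hT d (.inl rfl))) =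
      bipyramidHub hT d (.inl rfl)) :
    H.deleteEdges (cutEdges H r k) ∈ bipyramidStage hd T 3 ∧
      (2 * d ≤ (k (H.connectedComponentMk (bipyramidHub hT d (.inl rfl))) : ℕ) →
        H.deleteEdges (cutEdges H r k) ∈ bipyramidStage hd T 4) := by
  obtain ⟨hHG, hH⟩ := hH
  have hle := (H.deleteEdges_le (cutEdges H r k)).trans hHG
  have key := fun a' b' => ContainsRows.deleteEdges_of_hub hd hT (.inl rfl) hHG hH (by omega)
    le_rfl hR k hr (a' := a') (b' := b')
  refine ⟨⟨hle, ?_⟩, fun hk => ⟨hle, key _ _ le_rfl le_rfl le_rfl le_rfl ?_⟩⟩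
  · rcases lt_or_ge (k (H.connectedComponentMk (bipyramidHub hT d (.inl rfl))) : ℕ) d with h | h
    · exact .inr (key _ _ le_rfl (by omega) le_rfl (by omega) (by intros; omega))
    · exact .inl (key _ _ (by omega) le_rfl (by omega) le_rfl (by intros; omega))
  · intros; omega

/-- Row `0` lies entirely at distance `d` from the hub, so no offset cuts a cycle edge, and only
offsets below `d` damage the paths to this hub. This gives the one factor `d` instead of `2 d`. -/
theorem bipyramidStage_three_step (hd : 1 ≤ d) (hT : d ≤ T) (hR : 2 * d < R) {h : ℤ}
    (hh : h = d ∨ h = -d) {H : SimpleGraph (bipyramidCells d T)} (hHG : H ≤ bipyramid d T)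
    (hH : ContainsRows (bipyramid d T) H (min h 0) (max h 0))
    {r : H.ConnectedComponent → bipyramidCells d T} (k : H.ConnectedComponent → Fin R)
    (hr : r (H.connectedComponentMk (bipyramidHub hT h hh)) = bipyramidHub hT h hh) :
    H.deleteEdges (cutEdges H r k) ∈ bipyramidStage hd T 2 ∧
      (d ≤ (k (H.connectedComponentMk (bipyramidHub hT h hh)) : ℕ) →
        H.deleteEdges (cutEdges H r k) ∈ bipyramidStage hd T 3) := by
  have hle := (H.deleteEdges_le (cutEdges H r k)).trans hHG
  have key := fun a' b' => ContainsRows.deleteEdges_of_hub hd hT hh hHG hH (by omega)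
    (by omega) hR k hr (a' := a') (b' := b')
  refine ⟨⟨hle, key 0 0 (by omega) (by omega) (by omega) (by omega) (by intros; omega)⟩,
    fun hk => ⟨hle, ?_⟩⟩
  rcases hh with hh' | hh'
  · exact .inl (key 0 d (by omega) (by omega) (by omega) (by omega) (by intros; omega))
  · exact .inr (key (-d) 0 (by omega) (by omega) (by omega) (by omega) (by intros; omega))

/-- Both `d` and `2 d` are at distance `d` from cycle vertex `0`. An offset below `d` cuts only the
arms from `0` to them and spares the arc between; an offset of at least `d` spares both arms, which
form a walk of length `2 d`. -/
theorem bipyramidStage_two_step (hd : 1 ≤ d) (hR : 2 * d < R)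
    {H : SimpleGraph (bipyramidCells d T)} (hH : H ∈ bipyramidStage hd T 2)
    {r : H.ConnectedComponent → bipyramidCells d T} (k : H.ConnectedComponent → Fin R)
    (hr : r (H.connectedComponentMk (bipyramidCycle hd 0 (by omega))) =
      bipyramidCycle hd 0 (by omega)) :
    H.deleteEdges (cutEdges H r k) ∈ bipyramidStage hd T 1 ∧
      (2 * d ≤ (k (H.connectedComponentMk (bipyramidCycle hd 0 (by omega))) : ℕ) →
        H.deleteEdges (cutEdges H r k) ∈ bipyramidStage hd T 2) := by
  obtain ⟨hHG, hH⟩ := hH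
  have hle := (H.deleteEdges_le (cutEdges H r k)).trans hHG
  have hrow : ∀ p : bipyramidCells d T, p.1.2 = 0 → 0 ≤ p.1.1 ∧ p.1.1 < 3 * d := by
    rintro ⟨⟨i, j⟩, h⟩ h0
    rw [mem_bipyramidCells] at h
    simp only at h0 ⊢
    omega
  have key : ∀ p q, (bipyramid d T).Adj p q → p.1.2 = 0 → q.1.2 = 0 →
      (∀ z ∈ ({p, q} : Set (bipyramidCells d T)),
        ((k (H.connectedComponentMk (bipyramidCycle hd 0 (by omega))) : ℕ) : ℤ) =
          cycleDist d z.1.1 →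
        cycleDist d p.1.1 ≤ cycleDist d z.1.1 ∧ cycleDist d q.1.1 ≤ cycleDist d z.1.1) →
      (H.deleteEdges (cutEdges H r k)).Adj p q := by
    intro p q hpq hp hq hz
    obtain ⟨hp1, hp2⟩ := bipyramid_cycle_dist hd hHG hH p hp
    obtain ⟨hq1, hq2⟩ := bipyramid_cycle_dist hd hHG hH q hq
    have hp' := hrow p hp
    have hq' := hrow q hq
    refine adj_deleteEdges_cutEdges hr hp1 (hH p q hpq hp.ge hp.le hq.ge hq.le) ?_ ?_
    · rintro z (rfl | rfl) hk
      · have := hz z (by simp) (by omega)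
        omega
      · have := hz z (by simp) (by omega)
        omega
    · simp only [cycleDist] at hp2 hq2
      omega
  refine ⟨⟨hle, ?_⟩, fun hk => ⟨hle, ?_⟩⟩
  · rcases lt_or_ge (k (H.connectedComponentMk (bipyramidCycle hd 0 (by omega))) : ℕ) d with h | h
    · obtain ⟨p, hp⟩ := exists_walk_segment (H := H.deleteEdges (cutEdges H r k)) hd (by
        intro p q hpq hp hq h1 h2 h3 h4
        refine key p q hpq hp hq ?_
        rintro z (rfl | rfl) hz <;> simp only [cycleDist] at hz <;> omega)
      exact ⟨p, by omega⟩
    · have hw := exists_walk_cycle (H := H.deleteEdges (cutEdges H r k)) (m := d) hd (by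
        intro p q hpq hp hq h1 h2
        refine key p q hpq hp hq ?_
        rintro z (rfl | rfl) hz <;> omega)
      obtain ⟨p, hp⟩ := hw (bipyramidCycle hd d (by omega)) rfl
        (by simp only [cycleDist, bipyramidCycle_coe]; omega)
      obtain ⟨q, hq⟩ := hw (bipyramidCycle hd (2 * d) (by omega)) rfl
        (by simp only [cycleDist, bipyramidCycle_coe]; omega)
      simp only [cycleDist, bipyramidCycle_coe] at hp hq
      refine ⟨p.reverse.append q, ?_⟩
      rw [SimpleGraph.Walk.length_append, SimpleGraph.Walk.length_reverse]
      omega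
  · intro p q hpq h1 h2 h3 h4
    have hp := le_antisymm h2 h1
    have hq := le_antisymm h4 h3
    have hp' := hrow p hp
    have hq' := hrow q hq
    refine key p q hpq hp hq ?_
    -- No cycle vertex is at distance `2 d` or more from `0`, since `cycleDist` is at most `3 d /
    -- 2`.
    rintro z (rfl | rfl) hz <;> simp only [cycleDist] at hz <;> omega

theorem bipyramidStage_step (hd : 1 ≤ d) (hT : d ≤ T) (hR : 2 * d < R) (m j : ℕ) (hj : j < 4)
    (H : SimpleGraph (bipyramidCells d T)) (hH : H ∈ bipyramidStage hd T (j + 1))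
    (hH2 : H ∉ bipyramidStage hd T (j + 2)) :
    ∃ C : H.ConnectedComponent, ∀ k : H.ConnectedComponent → Fin R,
      H.deleteEdges (cutEdges H ((RootRule.ofPreferred (bipyramidRoot hd hT)).root m H) k) ∈
        bipyramidStage hd T j ∧
      (bipyramidLoss d (j + 1) ≤ (k C : ℕ) →
        H.deleteEdges (cutEdges H ((RootRule.ofPreferred (bipyramidRoot hd hT)).root m H) k) ∈
          bipyramidStage hd T (j + 1)) := by
  refine ⟨H.connectedComponentMk (bipyramidRoot hd hT H), fun k => ?_⟩
  have hr := RootRule.ofPreferred_root (bipyramidRoot hd hT) m H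
  generalize (RootRule.ofPreferred (bipyramidRoot hd hT)).root m H = r at hr ⊢
  match j, hj, hH, hH2 with
  | 0, _, hH, hH2 =>
    have h0 : ¬ ContainsRows (bipyramid d T) H 0 0 := fun h => hH2 ⟨hH.1, h⟩
    have hroot : bipyramidRoot hd hT H = bipyramidCycle hd d (by omega) := by
      unfold bipyramidRoot
      rw [if_neg (fun h => h0 (h.mono le_rfl (by omega))),
        if_neg (fun h => h0 (h.mono (by omega) le_rfl)), if_neg h0]
    rw [hroot] at hr ⊢
    obtain ⟨hHG, p, hp⟩ := hH
    exact ⟨trivial, fun hk => ⟨(H.deleteEdges_le _).trans hHG,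
      exists_walk_deleteEdges_cutEdges hr p hp hk⟩⟩
  | 1, _, hH, hH2 =>
    have hroot : bipyramidRoot hd hT H = bipyramidCycle hd 0 (by omega) := by
      unfold bipyramidRoot
      rw [if_neg (fun h => hH2 ⟨hH.1, .inl h⟩), if_neg (fun h => hH2 ⟨hH.1, .inr h⟩),
        if_pos hH.2]
    rw [hroot] at hr ⊢
    exact bipyramidStage_two_step hd hR hH k hr
  | 2, _, hH, hH2 =>
    by_cases h : ContainsRows (bipyramid d T) H 0 d
    · have hroot : bipyramidRoot hd hT H = bipyramidHub hT d (.inl rfl) := if_pos h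
      rw [hroot] at hr ⊢
      exact bipyramidStage_three_step hd hT hR (.inl rfl) hH.1
        (h.mono (by omega) (by omega)) k hr
    · have h' := hH.2.resolve_left h
      have hroot : bipyramidRoot hd hT H = bipyramidHub hT (-d) (.inr rfl) := by
        unfold bipyramidRoot
        rw [if_neg h, if_pos h']
      rw [hroot] at hr ⊢
      exact bipyramidStage_three_step hd hT hR (.inr rfl) hH.1
        (h'.mono (by omega) (by omega)) k hr
  | 3, _, hH, hH2 =>
    have hroot : bipyramidRoot hd hT H = bipyramidHub hT d (.inl rfl) :=
      if_pos (hH.2.mono (by omega) le_rfl)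
    rw [hroot] at hr ⊢
    exact bipyramidStage_four_step hd hT hR hH k hr

theorem bipyramid_kprSepProb_le (hd : 1 ≤ d) (hT : d ≤ T) [NeZero R] (hR : 2 * d < R) :
    kprSepProb R (RootRule.ofPreferred (bipyramidRoot hd hT)) (bipyramid d T) 4
      (bipyramidCycle hd d (by omega)) (bipyramidCycle hd (2 * d) (by omega)) ≤
      8 * ((d : ℝ) / R) ^ 4 := by
  have h := kpr_four_phases R (RootRule.ofPreferred (bipyramidRoot hd hT)) (bipyramid d T)
    (bipyramidStage hd T) (bipyramidLoss d) ⟨le_rfl, fun p q h _ _ _ _ => h⟩ rfl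
    (bipyramidStage_succ_subset hd) (bipyramidStage_step hd hT hR)
  have h2 : (kpr R (RootRule.ofPreferred (bipyramidRoot hd hT)) (bipyramid d T) 4).toOuterMeasure
      {H | ¬ H.Reachable (bipyramidCycle hd d (by omega)) (bipyramidCycle hd (2 * d) (by omega))} ≤
      (((2 * d : ℕ) : ENNReal) / R) * ((d : ℕ) / R) * ((2 * d : ℕ) / R) * ((2 * d : ℕ) / R) :=
    (MeasureTheory.measure_mono (by
      rintro H hH ⟨-, p, -⟩
      exact hH p.reachable)).trans h
  have hR0 : (R : ENNReal) ≠ 0 := by exact_mod_cast NeZero.ne R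
  have hfin : ∀ n : ℕ, (n : ENNReal) / R ≠ ⊤ := fun n =>
    ENNReal.div_ne_top (ENNReal.natCast_ne_top n) hR0
  refine (ENNReal.toReal_mono (ENNReal.mul_ne_top (ENNReal.mul_ne_top (ENNReal.mul_ne_top
    (hfin _) (hfin _)) (hfin _)) (hfin _)) h2).trans (le_of_eq ?_)
  simp only [ENNReal.toReal_mul, ENNReal.toReal_div, ENNReal.toReal_natCast]
  push_cast
  ring

end Stages

/-! ### Planarity: an explicit drawing -/

theorem isPlanar_of_orientation {V : Type*} (G : SimpleGraph V) (D : V → V → Prop)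
    (hD : ∀ x y, G.Adj x y → D x y ∨ D y x) (point : V → ℝ × ℝ)
    (γ : V → V → ℝ → ℝ × ℝ) (hpoint : Function.Injective point)
    (hcont : ∀ x y, D x y → Continuous (γ x y))
    (hinj : ∀ x y, D x y → Set.InjOn (γ x y) (Set.Icc 0 1))
    (h0 : ∀ x y, D x y → γ x y 0 = point x) (h1 : ∀ x y, D x y → γ x y 1 = point y)
    (havoid : ∀ x y, D x y → ∀ t ∈ Set.Ioo (0 : ℝ) 1, ∀ z, γ x y t ≠ point z)
    (hdisj : ∀ x y x' y', D x y → D x' y' → ∀ s ∈ Set.Ioo (0 : ℝ) 1, ∀ t ∈ Set.Ioo (0 : ℝ) 1,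
      γ x y s = γ x' y' t → x = x' ∧ y = y') : IsPlanar G := by
  have hor : ∀ e : G.edgeSet, ∃ p : V × V, (e : Sym2 V) = s(p.1, p.2) ∧ D p.1 p.2 := by
    rintro ⟨e, he⟩
    induction e using Sym2.ind with
    | _ x y =>
      rcases hD x y he with h | h
      · exact ⟨(x, y), rfl, h⟩
      · exact ⟨(y, x), Sym2.eq_swap, h⟩
  choose o ho hoD using hor
  refine ⟨point, fun e => γ (o e).1 (o e).2, hpoint,
    fun e => ⟨(hcont _ _ (hoD e)).continuousOn, hinj _ _ (hoD e)⟩, fun e => ?_,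
    fun e => havoid _ _ (hoD e), fun e f hef s hs t ht h => hef ?_⟩
  · beta_reduce
    rw [h0 _ _ (hoD e), h1 _ _ (hoD e), ho e, Sym2.map_mk]
  · obtain ⟨ha, hb⟩ := hdisj _ _ _ _ (hoD e) (hoD f) s hs t ht h
    exact Subtype.ext (by rw [ho e, ho f, ha, hb])

/-- An arc from `(0, 0)` to `(m, 0)` that runs around the region `[0, m] × (-∞, A / 12]`. -/
noncomputable def detour (m A : ℝ) (t : ℝ) : ℝ × ℝ :=
  (m * (t - 2 * (t * (1 - t) * (1 - 2 * t))), A * (t * (1 - t)))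

theorem detour_continuous (m A : ℝ) : Continuous (detour m A) := by
  unfold detour
  fun_prop

/-- Equal heights force `t = s` or `t = 1 - s`; in the latter case equal abscissas force `s = 1 /
2`. -/
theorem detour_injective {m A : ℝ} (hm : 0 < m) (hA : 0 < A) :
    Set.InjOn (detour m A) (Set.Icc 0 1) := by
  intro s hs t ht h
  simp only [detour, Prod.mk.injEq] at h
  obtain ⟨h1, h2⟩ := h
  have h1 := mul_left_cancel₀ hm.ne' h1
  have h2 := mul_left_cancel₀ hA.ne' h2
  have h3 : (s - t) * (1 - s - t) = 0 := by linear_combination h2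
  rcases mul_eq_zero.mp h3 with h | h
  · linarith
  · obtain rfl : t = 1 - s := by linarith
    have h4 : (2 * s - 1) * (1 + 4 * (s * (1 - s))) = 0 := by linear_combination h1
    have h5 : 0 ≤ s * (1 - s) := mul_nonneg hs.1 (by linarith [hs.2])
    rcases mul_eq_zero.mp h4 with h | h <;> linarith

theorem detour_avoids {m A : ℝ} (hm : 0 < m) (hA : 0 < A) {t : ℝ} (ht : t ∈ Set.Ioo (0 : ℝ) 1)
    (h0 : 0 ≤ (detour m A t).1) (h1 : (detour m A t).1 ≤ m) : A / 12 < (detour m A t).2 := by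
  obtain ⟨ht0, ht1⟩ := ht
  simp only [detour] at h0 h1 ⊢
  have h0' : 0 ≤ t * (1 - 2 * ((1 - t) * (1 - 2 * t))) := by
    have := nonneg_of_mul_nonneg_right h0 hm
    linarith
  have h1' : 0 ≤ (1 - t) * (1 + 2 * (t * (1 - 2 * t))) := by
    have : m * (t - 2 * (t * (1 - t) * (1 - 2 * t))) ≤ m * 1 := by linarith
    have := le_of_mul_le_mul_left this hm
    linarith
  have h0'' := nonneg_of_mul_nonneg_right h0' ht0
  have h1'' := nonneg_of_mul_nonneg_right h1' (by linarith : 0 < 1 - t)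
  -- For `t ≤ 1 / 10` the curve is still left of `0`, and by symmetry it is right of `m` near `1`.
  -- In between, `t (1 - t) > 9 / 100 > 1 / 12`.
  have h2 : (1 : ℝ) / 10 < t := by
    by_contra h
    nlinarith
  have h3 : t < 9 / 10 := by
    by_contra h
    nlinarith
  have : 1 / 12 < t * (1 - t) := by nlinarith
  nlinarith

theorem int_add_eq {a b : ℤ} {s t : ℝ} (hs : s ∈ Set.Ioo (0 : ℝ) 1) (ht : t ∈ Set.Ioo (0 : ℝ) 1)
    (h : (a : ℝ) + s = b + t) : a = b ∧ s = t := by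
  have h1 : (a : ℝ) < b + 1 := by linarith [hs.1, ht.2]
  have h2 : (b : ℝ) < a + 1 := by linarith [hs.2, ht.1]
  have h1 : a < b + 1 := by exact_mod_cast h1
  have h2 : b < a + 1 := by exact_mod_cast h2
  obtain rfl : a = b := by omega
  exact ⟨rfl, by linarith⟩

theorem int_add_ne {a b : ℤ} {s : ℝ} (hs : s ∈ Set.Ioo (0 : ℝ) 1) : (a : ℝ) + s ≠ b := by
  intro h
  have h1 : (a : ℝ) < b := by linarith [hs.1]
  have h2 : (b : ℝ) < a + 1 := by linarith [hs.2]
  have h1 : a < b := by exact_mod_cast h1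
  have h2 : b < a + 1 := by exact_mod_cast h2
  omega

/-- The straight segment between two lattice points. -/
noncomputable def latticeSegment (p q : ℤ × ℤ) (t : ℝ) : ℝ × ℝ :=
  (p.1 + t * (q.1 - p.1), p.2 + t * (q.2 - p.2))

open Classical in
/-- The drawing of the edges of the bipyramid: all of them are straight segments except one edge
of the cycle. -/
noncomputable def bipyramidArc (d : ℕ) (T : ℤ) (p q : ℤ × ℤ) : ℝ → ℝ × ℝ :=
  if p.2 = q.2 ∧ q.1 ≠ p.1 + 1 then detour (3 * d - 1) (12 * T) else latticeSegment p q

/-- The three shapes of oriented edges of the bipyramid. -/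
theorem BipyramidStep.cases {d : ℕ} {T : ℤ} {p q : ℤ × ℤ} (hd : 1 ≤ d)
    (h : BipyramidStep d p q) (hp : p ∈ bipyramidCells d T) (hq : q ∈ bipyramidCells d T) :
    (bipyramidArc d T p q = latticeSegment p q ∧ q.2 = p.2 + 1 ∧
      (p.1 = q.1 ∨ q = (0, (d : ℤ)) ∨ p = (0, -(d : ℤ)))) ∨
    (bipyramidArc d T p q = latticeSegment p q ∧ p.2 = 0 ∧ q.2 = 0 ∧ q.1 = p.1 + 1) ∨
    (bipyramidArc d T p q = detour (3 * d - 1) (12 * T) ∧ p = (0, 0) ∧ q = (3 * (d : ℤ) - 1, 0)) := by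
  obtain ⟨i, j⟩ := p
  obtain ⟨i', j'⟩ := q
  simp only [BipyramidStep] at h
  rcases h with ⟨h1, h2⟩ | ⟨h1, h2, h3⟩ | ⟨h1, h2, h3, h4⟩
  · refine .inl ⟨if_neg (by simp only; omega), h1, ?_⟩
    simp only [Prod.mk.injEq]
    omega
  · exact .inr (.inl ⟨if_neg (by simp only; omega), h1, h2, h3⟩)
  · refine .inr (.inr ⟨if_pos (by simp only; omega), ?_, ?_⟩) <;>
    · simp only [Prod.mk.injEq]
      omega

theorem latticeSegment_mem_box {d : ℕ} {T : ℤ} (hT : d ≤ T) (hd : 1 ≤ d) {p q : ℤ × ℤ}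
    (hp : p ∈ bipyramidCells d T) (hq : q ∈ bipyramidCells d T) {t : ℝ}
    (ht : t ∈ Set.Icc (0 : ℝ) 1) :
    0 ≤ (latticeSegment p q t).1 ∧ (latticeSegment p q t).1 ≤ 3 * d - 1 ∧
      (latticeSegment p q t).2 ≤ T := by
  have key : ∀ p ∈ bipyramidCells d T, (0 : ℝ) ≤ p.1 ∧ (p.1 : ℝ) ≤ 3 * d - 1 ∧ (p.2 : ℝ) ≤ T := by
    rintro ⟨i, j⟩ h
    rw [mem_bipyramidCells] at h
    have h1 : 0 ≤ i := by omega
    have h2 : i ≤ 3 * d - 1 := by omega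
    have h3 : j ≤ T := by omega
    exact ⟨by exact_mod_cast h1, by exact_mod_cast h2, by exact_mod_cast h3⟩
  obtain ⟨a1, a2, a3⟩ := key p hp
  obtain ⟨b1, b2, b3⟩ := key q hq
  obtain ⟨t0, t1⟩ := ht
  simp only [latticeSegment]
  refine ⟨?_, ?_, ?_⟩ <;> nlinarith

/-- All straight edges lie in the box `[0, 3 d - 1] × (-∞, T]`, which the open arc of the closing
edge avoids because its parameter is `12 T`. Straight edges climb one row or advance one column, so
integer and fractional parts of a coordinate separate them from vertices and mostly from one
another; only edges between the same two rows need a comparison of abscissas. -/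
theorem bipyramid_isPlanar {d : ℕ} {T : ℤ} (hd : 1 ≤ d) (hT : d ≤ T) :
    IsPlanar (bipyramid d T) := by
  have hm : (0 : ℝ) < 3 * d - 1 := by
    have : (1 : ℝ) ≤ d := by exact_mod_cast hd
    linarith
  have hTpos : (0 : ℝ) < 12 * T := by
    have : (1 : ℤ) ≤ T := by omega
    have : (1 : ℝ) ≤ T := by exact_mod_cast this
    linarith
  have hseg0 : ∀ p q : ℤ × ℤ, latticeSegment p q 0 = ((p.1 : ℝ), (p.2 : ℝ)) := by
    intro p q; simp [latticeSegment]
  have hbox : ∀ p ∈ bipyramidCells d T, ∀ q ∈ bipyramidCells d T, ∀ s ∈ Set.Icc (0 : ℝ) 1,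
      ∀ t ∈ Set.Ioo (0 : ℝ) 1, detour (3 * d - 1) (12 * T) t ≠ latticeSegment p q s := by
    intro p hp q hq s hs t ht h
    obtain ⟨h1, h2, h3⟩ := latticeSegment_mem_box hT hd hp hq hs
    rw [← h] at h1 h2 h3
    have := detour_avoids hm hTpos ht h1 h2
    linarith
  refine isPlanar_of_orientation (bipyramid d T) (fun x y => BipyramidStep d x.1 y.1)
    (fun x y h => h) (fun x => ((x.1.1 : ℝ), (x.1.2 : ℝ))) (fun x y => bipyramidArc d T x.1 y.1)
    ?_ ?_ ?_ ?_ ?_ ?_ ?_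
  · rintro ⟨⟨i, j⟩, h⟩ ⟨⟨i', j'⟩, h'⟩ he
    simp only [Prod.mk.injEq, Int.cast_inj] at he
    simp only [Subtype.mk.injEq, Prod.mk.injEq]
    exact he
  · intro x y h
    have hs : Continuous (latticeSegment x.1 y.1) := by unfold latticeSegment; fun_prop
    rcases h.cases hd x.2 y.2 with ⟨h, -⟩ | ⟨h, -⟩ | ⟨h, -⟩ <;> rw [h]
    exacts [hs, hs, detour_continuous _ _]
  · intro x y h
    rcases h.cases hd x.2 y.2 with ⟨h, h1, -⟩ | ⟨h, -, -, h1⟩ | ⟨h, -⟩ <;> rw [h]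
    · intro s _ t _ hst
      simp only [latticeSegment, h1, Prod.mk.injEq] at hst
      have := hst.2
      push_cast at this
      linarith
    · intro s _ t _ hst
      simp only [latticeSegment, h1, Prod.mk.injEq] at hst
      have := hst.1
      push_cast at this
      linarith
    · exact detour_injective hm hTpos
  · intro x y h
    rcases h.cases hd x.2 y.2 with ⟨h, -⟩ | ⟨h, -⟩ | ⟨h, h1, -⟩ <;> rw [h]
    · exact hseg0 _ _
    · exact hseg0 _ _
    · simp [detour, h1]
  · intro x y h
    rcases h.cases hd x.2 y.2 with ⟨h, -⟩ | ⟨h, -⟩ | ⟨h, -, h1⟩ <;> rw [h]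
    · simp [latticeSegment]
    · simp [latticeSegment]
    · simp [detour, h1]
  · intro x y h t ht z
    rcases h.cases hd x.2 y.2 with ⟨h, h1, -⟩ | ⟨h, -, -, h1⟩ | ⟨h, -⟩ <;> rw [h]
    · intro he
      refine int_add_ne (a := x.1.2) (b := z.1.2) ht ?_
      have := congrArg Prod.snd he
      simp only [latticeSegment, h1] at this
      push_cast at this
      linarith
    · intro he
      refine int_add_ne (a := x.1.1) (b := z.1.1) ht ?_
      have := congrArg Prod.fst he
      simp only [latticeSegment, h1] at this
      push_cast at this
      linarith
    -- A vertex is a degenerate segment, so the box bound applies to it too.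
    · rw [← hseg0 z.1 z.1]
      exact hbox _ z.2 _ z.2 0 (by simp) t ht
  · intro x y x' y' h h' s hs t ht he
    have key : x.1 = x'.1 ∧ y.1 = y'.1 → x = x' ∧ y = y' :=
      fun h => ⟨Subtype.ext h.1, Subtype.ext h.2⟩
    have hs' := Set.Ioo_subset_Icc_self hs
    have ht' := Set.Ioo_subset_Icc_self ht
    apply key
    obtain ⟨⟨i, j⟩, hx⟩ := x
    obtain ⟨⟨k, l⟩, hy⟩ := y
    obtain ⟨⟨i', j'⟩, hx'⟩ := x'
    obtain ⟨⟨k', l'⟩, hy'⟩ := y'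
    simp only at h h' he ⊢
    rcases h.cases hd hx hy with ⟨e, h1, h2⟩ | ⟨e, h1, h2, h3⟩ | ⟨e, h1, h2⟩ <;>
    rcases h'.cases hd hx' hy' with ⟨e', h1', h2'⟩ | ⟨e', h1', h2', h3'⟩ | ⟨e', h1', h2'⟩ <;>
    rw [e, e'] at he
    · simp only at h1 h1'
      subst h1 h1'
      simp only [latticeSegment, Prod.mk.injEq] at he
      obtain ⟨he1, he2⟩ := he
      obtain ⟨rfl, rfl⟩ := int_add_eq (a := j) (b := j') hs ht (by push_cast at he2; linarith)
      have e1 : (i : ℝ) * (1 - s) + k * s = i' * (1 - s) + k' * s := by linarith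
      have hs0 := hs.1
      have hs1 : 0 < 1 - s := by linarith [hs.2]
      have hik : (i = i' ∨ k = k') → i = i' ∧ k = k' := by
        rintro (rfl | rfl)
        · have : (k : ℝ) * s = k' * s := by linarith
          exact ⟨rfl, by exact_mod_cast mul_right_cancel₀ hs0.ne' this⟩
        · have : (i : ℝ) * (1 - s) = i' * (1 - s) := by linarith
          exact ⟨by exact_mod_cast mul_right_cancel₀ hs1.ne' this, rfl⟩
      -- Edges between the same two rows both end at the upper hub, both start at the lower hub, or
      -- are both vertical.
      have hor : i = i' ∨ k = k' ∨ (i = k ∧ i' = k') := by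
        rw [mem_bipyramidCells] at hx hy hx' hy'
        simp only [Prod.mk.injEq] at h2 h2'
        omega
      have : i = i' ∧ k = k' := by
        rcases hor with h | h | ⟨rfl, rfl⟩
        · exact hik (.inl h)
        · exact hik (.inr h)
        · have : (i : ℝ) = i' := by linarith
          exact ⟨by exact_mod_cast this, by exact_mod_cast this⟩
      simp [this]
    · exfalso
      simp only at h1 h1' h2'
      subst h1 h1' h2'
      simp only [latticeSegment, Prod.mk.injEq] at he
      refine int_add_ne (a := j) (b := 0) hs ?_
      have := he.2
      push_cast at this ⊢
      linarith
    · exact (hbox _ hx _ hy s hs' t ht he.symm).elim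
    · exfalso
      simp only at h1 h1' h2
      subst h1 h1' h2
      simp only [latticeSegment, Prod.mk.injEq] at he
      refine int_add_ne (a := j') (b := 0) ht ?_
      have := he.2
      push_cast at this ⊢
      linarith
    · simp only at h1 h2 h3 h1' h2' h3'
      subst h1 h2 h3 h1' h2' h3'
      simp only [latticeSegment, Prod.mk.injEq] at he
      obtain ⟨rfl, -⟩ := int_add_eq (a := i) (b := i') hs ht (by
        have := he.1
        push_cast at this
        linarith)
      exact ⟨rfl, rfl⟩
    · exact (hbox _ hx _ hy s hs' t ht he.symm).elim
    · exact (hbox _ hx' _ hy' t ht' s hs he).elim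
    · exact (hbox _ hx' _ hy' t ht' s hs he).elim
    · exact ⟨h1.trans h1'.symm, h2.trans h2'.symm⟩

/-! ### Choosing the size of the graph -/

theorem mainTheorem7 (n d : ℕ) (hd : 1 ≤ d) (hdn : (d : ℝ) ≤ Real.sqrt n / 3) :
    ∃ (V : Type) (_ : Fintype V) (G : SimpleGraph V) (u v : V),
      Fintype.card V = n ∧ IsPlanar G ∧ G.Connected ∧ G.dist u v = d ∧
      ∃ ρ : RootRule V, ∀ (R : ℕ) [NeZero R], 2 * d < R →
        kprSepProb R ρ G 4 u v ≤ 8 * ((G.dist u v : ℝ) / R) ^ 4 := by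
  have hn : 9 * (d : ℤ) ^ 2 ≤ n := by
    have h1 : 3 * (d : ℝ) ≤ Real.sqrt n := by linarith
    have h2 : (3 * (d : ℝ)) ^ 2 ≤ n := by
      rw [← Real.sq_sqrt (Nat.cast_nonneg n : (0 : ℝ) ≤ n)]
      gcongr
    have h3 : 9 * (d : ℝ) ^ 2 ≤ n := by linarith
    exact_mod_cast h3
  -- This solves `card_bipyramidCells` for exactly `n` vertices; `d ≤ T` then amounts to `6 d ^ 2 -
  -- 3 d + 2 ≤ n`, which follows from `9 d ^ 2 ≤ n`.
  set T : ℤ := n - 3 * d * (2 * d - 1) + d - 2 with hTdef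
  have hd' : (1 : ℤ) ≤ d := by exact_mod_cast hd
  have hT : (d : ℤ) ≤ T := by nlinarith
  refine ⟨bipyramidCells d T, inferInstance, bipyramid d T, bipyramidCycle hd d (by omega),
    bipyramidCycle hd (2 * d) (by omega), ?_, bipyramid_isPlanar hd hT, bipyramid_connected hd hT,
    bipyramid_dist hd, RootRule.ofPreferred (bipyramidRoot hd hT), fun R _ hR => ?_⟩
  · have := card_bipyramidCells hT hd
    rw [Fintype.card_coe]
    have h : ((bipyramidCells d T).card : ℤ) = n := by rw [this, hTdef]; ring
    exact_mod_cast h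
  · rw [bipyramid_dist hd]
    exact bipyramid_kprSepProb_le hd hT hR
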